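/- A pointclass $\boldsymbol{\Gamma}$ is a collection of subsets of Polish spaces closed under continuous preimages. Call $\boldsymbol{\Gamma}$ reasonable if (1) whenever $A\subseteq X$ is in $\boldsymbol{\Gamma}$ and $B\subseteq X$ is $\boldsymbol{\Delta}^0_6$, both $A\cup B$ and $A\cap B$ are in $\boldsymbol{\Gamma}$, and (2) whenever $f\colon X\to Y$ is a $\boldsymbol{\Delta}^0_6$-measurable function between Polish spaces (preimages of open sets are $\boldsymbol{\Delta}^0_6$) and $A\subseteq Y$ is in $\boldsymbol{\Gamma}$, then $f^{-1}(A)$ is in $\boldsymbol{\Gamma}$. A set $A\subseteq\omega^\omega$ is determined if one of the players I, II has a winning strategy in the game in which they alternately play natural numbers $x(0),x(1),x(2),\dots$ (I moves first) and I wins iff $x\in A$. $\boldsymbol{\Gamma}$-determinacy is the assertion that every $A\subseteq\omega^\omega$ in $\boldsymbol{\Gamma}$ is determined. For an equivalence relation $E$ on a Polish space $X$, $(\boldsymbol{\Gamma},E)$-determinacy is the assertion that for every continuous onto map $\pi\colon\omega^\omega\to X$ and every $E$-invariant set $A\subseteq X$ in $\boldsymbol{\Gamma}$, the set $\pi^{-1}(A)$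 is determined. Theorem. Let $X\subseteq 2^{\mathbb{Z}}$ be a subshift of finite type, that is, the set of all $x\in 2^{\mathbb{Z}}$ in which no word from some fixed finite set of finite binary words occurs, and let $E$ be the shift equivalence relation on $X$: $x\mathrel{E}y$ iff there is $m\in\mathbb{Z}$ with $y(k)=x(k-m)$ for all $k\in\mathbb{Z}$. Assume that $E$ has uncountably many classes. Then for every reasonable pointclass $\boldsymbol{\Gamma}$, $(\boldsymbol{\Gamma},E)$-determinacy implies $\boldsymbol{\Gamma}$-determinacy. -/

import Mathlib

/-! ### Finite levels of the Borel hierarchy -/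

/-- `IsSigma0 n A` : the set `A` is `Σ⁰ₙ` (boldface), for finite `n ≥ 1`. A set is `Σ⁰₁` if it is
open, and `Σ⁰ₙ₊₁` if it is a countable union of sets whose complements are `Σ⁰ₙ`. There is no
level `0`. -/
def IsSigma0 {X : Type*} [TopologicalSpace X] : ℕ → Set X → Prop
  | 0, _ => False
  | 1, A => IsOpen A
  | n + 2, A => ∃ F : ℕ → Set X, (∀ i, IsSigma0 (n + 1) (F i)ᶜ) ∧ A = ⋃ i, F i

/-- `A` is `Π⁰ₙ` if its complement is `Σ⁰ₙ`. -/
def IsPi0 {X : Type*} [TopologicalSpace X] (n : ℕ) (A : Set X) : Prop :=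
  IsSigma0 n Aᶜ

/-- `A` is `Δ⁰ₙ` if it is both `Σ⁰ₙ` and `Π⁰ₙ`. -/
def IsDelta0 {X : Type*} [TopologicalSpace X] (n : ℕ) (A : Set X) : Prop :=
  IsSigma0 n A ∧ IsPi0 n A

/-- `f` is `Δ⁰ₙ`-measurable if the preimage of every open set is `Δ⁰ₙ`. -/
def Delta0Measurable {X Y : Type*} [TopologicalSpace X] [TopologicalSpace Y] (n : ℕ)
    (f : X → Y) : Prop :=
  ∀ U : Set Y, IsOpen U → IsDelta0 n (f ⁻¹' U)

/-! ### Pointclasses -/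

/-- A pointclass: a collection of subsets of Polish spaces that is closed under continuous
preimages. `Γ.Mem A` says that the subset `A` of the Polish space `X` belongs to `Γ`. -/
structure Pointclass where
  Mem : ∀ {X : Type} [TopologicalSpace X] [PolishSpace X], Set X → Prop
  preimage_mem : ∀ {X Y : Type} [TopologicalSpace X] [PolishSpace X]
    [TopologicalSpace Y] [PolishSpace Y] (f : X → Y) (A : Set Y),
    Continuous f → Mem A → Mem (f ⁻¹' A)

/-- A reasonable pointclass is closed under unions and intersections with `Δ⁰₆` sets and under
substitution by `Δ⁰₆`-measurable functions. -/
structure Pointclass.IsReasonable (Γ : Pointclass) : Prop where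
  union_mem : ∀ {X : Type} [TopologicalSpace X] [PolishSpace X] (A B : Set X),
    Γ.Mem A → IsDelta0 6 B → Γ.Mem (A ∪ B)
  inter_mem : ∀ {X : Type} [TopologicalSpace X] [PolishSpace X] (A B : Set X),
    Γ.Mem A → IsDelta0 6 B → Γ.Mem (A ∩ B)
  subst_mem : ∀ {X Y : Type} [TopologicalSpace X] [PolishSpace X]
    [TopologicalSpace Y] [PolishSpace Y] (f : X → Y) (A : Set Y),
    Delta0Measurable 6 f → Γ.Mem A → Γ.Mem (f ⁻¹' A)

/-! ### Games on `ω` -/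

/-- The position `(x 0, …, x (n - 1))` of the run `x` after `n` moves. -/
def position (x : ℕ → ℕ) (n : ℕ) : List ℕ :=
  (List.range n).map x

/-- The run `x` is consistent with `σ` as a strategy for player I, who makes the moves
`x 0, x 2, x 4, …`. -/
def ConsistentI (σ : List ℕ → ℕ) (x : ℕ → ℕ) : Prop :=
  ∀ n : ℕ, x (2 * n) = σ (position x (2 * n))

/-- The run `x` is consistent with `τ` as a strategy for player II, who makes the moves
`x 1, x 3, x 5, …`. -/
def ConsistentII (τ : List ℕ → ℕ) (x : ℕ → ℕ) : Prop :=
  ∀ n : ℕ, x (2 * n + 1) = τ (position x (2 * n + 1))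

/-- The game on `ω` with payoff set `A`, in which player I wins the run `x` iff `x ∈ A`, is
determined: one of the two players has a winning strategy. -/
def Determined (A : Set (ℕ → ℕ)) : Prop :=
  (∃ σ : List ℕ → ℕ, ∀ x, ConsistentI σ x → x ∈ A) ∨
    (∃ τ : List ℕ → ℕ, ∀ x, ConsistentII τ x → x ∉ A)

/-- `Γ`-determinacy: every subset of `ω^ω` in `Γ` is determined. -/
def Pointclass.Determinacy (Γ : Pointclass) : Prop :=
  ∀ A : Set (ℕ → ℕ), Γ.Mem A → Determined A

/-- `(Γ, E)`-determinacy for an equivalence relation `E` on a Polish space `X`: for every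
continuous onto `π : ω^ω → X` and every `E`-invariant `A ⊆ X` in `Γ`, the set `π⁻¹(A)` is
determined. -/
def Pointclass.RelDeterminacy (Γ : Pointclass) {X : Type} [TopologicalSpace X] [PolishSpace X]
    (E : Setoid X) : Prop :=
  ∀ π : (ℕ → ℕ) → X, Continuous π → Function.Surjective π →
    ∀ A : Set X, Γ.Mem A → (∀ x y : X, E x y → (x ∈ A ↔ y ∈ A)) → Determined (π ⁻¹' A)

/-! ### Subshifts of finite type -/

/-- The word `w` occurs in `x` at place `k`: `x` restricted to `[k, k + |w|)` is `w`. -/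
def OccursAt (w : List Bool) (x : ℤ → Bool) (k : ℤ) : Prop :=
  ∀ i : Fin w.length, x (k + (i : ℤ)) = w.get i

/-- The subshift of finite type in `2^ℤ` given by the finite set `W` of forbidden words. -/
def subshift (W : Finset (List Bool)) : Set (ℤ → Bool) :=
  {x | ∀ k : ℤ, ∀ w ∈ W, ¬ OccursAt w x k}

theorem isClosed_subshift (W : Finset (List Bool)) : IsClosed (subshift W) := by
  have h : subshift W = ⋂ k : ℤ, ⋂ w ∈ W, ⋃ i : Fin w.length,
      {x : ℤ → Bool | x (k + (i : ℤ)) = w.get i}ᶜ := by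
    ext x
    simp [subshift, OccursAt]
  rw [h]
  refine isClosed_iInter fun k => isClosed_iInter fun w => isClosed_iInter fun _ =>
    isClosed_iUnion_of_finite fun i => ?_
  rw [isClosed_compl_iff]
  have ho : IsOpen ((fun x : ℤ → Bool => x (k + (i : ℤ))) ⁻¹' {w.get i}) :=
    (isOpen_discrete _).preimage (continuous_apply _)
  exact ho

/-- A subshift of finite type, with the topology induced by `2^ℤ`, is a Polish space. -/
instance polishSpace_subshift (W : Finset (List Bool)) : PolishSpace (subshift W) :=
  haveI : PolishSpace Bool := inferInstance
  (isClosed_subshift W).polishSpace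

/-- The shift equivalence relation on a subshift: `x` and `y` are equivalent iff `y = m · x` for
some `m : ℤ`, where `(m · x)(k) = x(k - m)`. -/
def shiftRel (W : Finset (List Bool)) : Setoid (subshift W) where
  r x y := ∃ m : ℤ, ∀ k : ℤ, y.1 k = x.1 (k - m)
  iseqv :=
    { refl := fun x => ⟨0, fun k => by simp⟩
      symm := by
        rintro x y ⟨m, h⟩
        exact ⟨-m, fun k => by rw [h]; simp⟩
      trans := by
        rintro x y z ⟨m, h⟩ ⟨n, h'⟩
        exact ⟨m + n, fun k => by rw [h', h, sub_sub, add_comm n m]⟩ }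

/-! ### Finite levels of the Borel hierarchy -/

/-! The classes of `E` are orbits of countably many continuous maps `T n`, so they are countable,
while `X` is uncountable. By Baire category `X` contains a Cantor set of pairwise inequivalent
points (`exists_continuous_pairwise_not_rel_of_orbit`). Placing the Baire space inside it gives a
continuous `φ : ω^ω → X` with pairwise inequivalent values.

For `A` in `Γ` let `B` be the `E`-saturation of `φ '' A`. The inverse of `φ` modulo `E` is
`Δ⁰₆`-measurable, so reasonableness puts `B` in `Γ`. To use the hypothesis on `B`, a continuous
surjection `π` is needed whose game is essentially the game for `A`. Player I's first move also
names an index `a`: either `π` is then `T n ∘ φ` for some `n`, and these maps cover the saturation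
of the range of `φ`, or `π` is a map whose range contains all remaining points and which enters `B`
only on runs in `A`. The choice of `a` cannot help player I, and some choice costs nothing, so
determinacy passes back to `A` (`Determined.of_preimage`). -/

theorem IsSigma0.preimage {X Y : Type*} [TopologicalSpace X] [TopologicalSpace Y] {f : X → Y}
    (hf : Continuous f) : ∀ {n : ℕ} {A : Set Y}, IsSigma0 n A → IsSigma0 n (f ⁻¹' A)
  | 0, _, h => h
  | 1, _, h => IsOpen.preimage hf h
  | n + 2, _, ⟨F, hF, hA⟩ =>
    ⟨fun i => f ⁻¹' F i, fun i => IsSigma0.preimage (n := n + 1) hf (hF i), by simp [hA]⟩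

theorem IsSigma0.iUnion {X : Type*} [TopologicalSpace X] {n : ℕ} {A : ℕ → Set X}
    (h : ∀ i, IsSigma0 (n + 2) (A i)) : IsSigma0 (n + 2) (⋃ i, A i) := by
  choose F hF hA using h
  refine ⟨fun k => F k.unpair.1 k.unpair.2, fun k => hF _ _, ?_⟩
  rw [Set.iUnion_unpair F]
  exact Set.iUnion_congr hA

theorem IsPi0.isSigma0_succ {X : Type*} [TopologicalSpace X] {n : ℕ} {A : Set X}
    (h : IsPi0 (n + 1) A) : IsSigma0 (n + 2) A :=
  ⟨fun _ => A, fun _ => h, (Set.iUnion_const A).symm⟩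

theorem IsOpen.isSigma0_two {X : Type*} [TopologicalSpace X] [TopologicalSpace.MetrizableSpace X]
    {A : Set X} (h : IsOpen A) : IsSigma0 2 A := by
  let := TopologicalSpace.metrizableSpaceMetric X
  obtain ⟨F, hF, -, hA, -⟩ := h.exists_iUnion_isClosed
  exact ⟨F, fun i => (hF i).isOpen_compl, hA.symm⟩

theorem IsClosed.isSigma0_two {X : Type*} [TopologicalSpace X] {A : Set X} (h : IsClosed A) :
    IsSigma0 2 A :=
  IsPi0.isSigma0_succ (n := 0) h.isOpen_compl

theorem IsSigma0.succ {X : Type*} [TopologicalSpace X] [TopologicalSpace.MetrizableSpace X] :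
    ∀ {n : ℕ} {A : Set X}, IsSigma0 n A → IsSigma0 (n + 1) A
  | 0, _, h => h.elim
  | 1, _, h => IsOpen.isSigma0_two h
  | n + 2, _, ⟨F, hF, hA⟩ => ⟨F, fun i => IsSigma0.succ (n := n + 1) (hF i), hA⟩

theorem IsSigma0.union {X : Type*} [TopologicalSpace X] {n : ℕ} {A B : Set X}
    (hA : IsSigma0 (n + 2) A) (hB : IsSigma0 (n + 2) B) : IsSigma0 (n + 2) (A ∪ B) := by
  have h : A ∪ B = ⋃ i : ℕ, if i = 0 then A else B := by
    ext x
    simp only [Set.mem_union, Set.mem_iUnion]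
    constructor
    · rintro (h | h)
      · exact ⟨0, by simpa using h⟩
      · exact ⟨1, by simpa using h⟩
    · rintro ⟨i, hi⟩
      split_ifs at hi
      exacts [Or.inl hi, Or.inr hi]
  rw [h]
  refine IsSigma0.iUnion fun i => ?_
  split_ifs <;> assumption

theorem IsSigma0.isDelta0_succ {X : Type*} [TopologicalSpace X]
    [TopologicalSpace.MetrizableSpace X] {n : ℕ} {A : Set X} (h : IsSigma0 (n + 1) A) :
    IsDelta0 (n + 2) A :=
  ⟨h.succ, IsPi0.isSigma0_succ (by rwa [IsPi0, compl_compl])⟩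

theorem IsSigma0.measurableSet {X : Type*} [TopologicalSpace X] [MeasurableSpace X]
    [OpensMeasurableSpace X] : ∀ {n : ℕ} {A : Set X}, IsSigma0 n A → MeasurableSet A
  | 0, _, h => h.elim
  | 1, _, h => IsOpen.measurableSet h
  | n + 2, _, ⟨_, hF, hA⟩ =>
    hA ▸ MeasurableSet.iUnion fun i =>
      (IsSigma0.measurableSet (n := n + 1) (hF i)).of_compl

/-- The image of a countable union of closed sets under a continuous map on a compact space. -/
theorem IsSigma0.image_of_compactSpace {X Y : Type*} [TopologicalSpace X] [CompactSpace X]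
    [TopologicalSpace Y] [T2Space Y] {f : X → Y} (hf : Continuous f) {A : Set X}
    (h : IsSigma0 2 A) : IsSigma0 2 (f '' A) := by
  obtain ⟨F, hF, rfl⟩ := h
  refine ⟨fun i => f '' F i, fun i => ?_, Set.image_iUnion⟩
  have hc : IsClosed (F i) := isOpen_compl_iff.1 (hF i)
  exact (hc.isCompact.image hf).isClosed.isOpen_compl

theorem isPi0_iInter {X : Type*} [TopologicalSpace X] {n : ℕ} {A : ℕ → Set X}
    (h : ∀ i, IsSigma0 (n + 1) (A i)) : IsPi0 (n + 2) (⋂ i, A i) :=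
  ⟨fun i => (A i)ᶜ, fun i => by simpa using h i, Set.compl_iInter A⟩

/-! ### Transfer of determinacy -/

theorem position_length (x : ℕ → ℕ) (n : ℕ) : (position x n).length = n := by
  simp [position]

theorem position_succ' (x : ℕ → ℕ) (n : ℕ) :
    position x (n + 1) = x 0 :: (List.range n).map fun k => x (k + 1) := by
  simp [position, List.range_succ_eq_map, Function.comp_def]

theorem position_update_zero (x : ℕ → ℕ) (c n : ℕ) :
    position (Function.update x 0 c) (n + 1) = c :: (position x (n + 1)).tail := by
  simp [position_succ']

/-- Determinacy passes from `π⁻¹(B)` to `A`, where the first move of player I in the run `x`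
codes a number `a` and a first move in the game for `A`, and `π(x)` is `p a` of the run so
obtained: `a` never helps player I, and some `a` does no harm. -/
theorem Determined.of_preimage {X : Type*} {A : Set (ℕ → ℕ)} {B : Set X}
    (p : ℕ → (ℕ → ℕ) → X) (hp : ∀ a y, p a y ∈ B → y ∈ A) (a₀ : ℕ)
    (ha₀ : ∀ y ∈ A, p a₀ y ∈ B)
    (h : Determined ((fun x : ℕ → ℕ =>
      p (x 0).unpair.1 (Function.update x 0 (x 0).unpair.2)) ⁻¹' B)) :
    Determined A := by
  rcases h with ⟨σ, hσ⟩ | ⟨τ, hτ⟩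
  · refine Or.inl ⟨fun l => if l = [] then (σ []).unpair.2 else σ (σ [] :: l.tail), ?_⟩
    intro y hy
    have hy0 : y 0 = (σ []).unpair.2 := by simpa [position] using hy 0
    have hx : ConsistentI σ (Function.update y 0 (σ [])) := by
      rintro (_ | n)
      · simp [position]
      · have h1 := hy (n + 1)
        have h2 : position y (2 * (n + 1)) ≠ [] := by
          rw [← List.length_pos_iff_ne_nil, position_length]; omega
        simp only [if_neg h2] at h1
        rw [Function.update_of_ne (by omega), h1]
        exact congrArg σ (position_update_zero y (σ []) (2 * n + 1)).symm
    have h3 := hσ _ hx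
    rw [Set.mem_preimage] at h3
    simp only [Function.update_self, Function.update_idem, ← hy0, Function.update_eq_self] at h3
    exact hp _ _ h3
  · refine Or.inr ⟨fun l => τ (Nat.pair a₀ l.headI :: l.tail), ?_⟩
    intro y hy hA
    have hx : ConsistentII τ (Function.update y 0 (Nat.pair a₀ (y 0))) := by
      intro n
      rw [Function.update_of_ne (by omega), hy n, position_update_zero]
      simp [position_succ']
    have h3 := hτ _ hx
    rw [Set.mem_preimage] at h3
    simp only [Function.update_self, Function.update_idem, Nat.unpair_pair,
      Function.update_eq_self] at h3
    exact h3 (ha₀ y hA)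

theorem continuous_of_first_move {X : Type*} [TopologicalSpace X] {p : ℕ → (ℕ → ℕ) → X}
    (hp : ∀ a, Continuous (p a)) :
    Continuous fun x : ℕ → ℕ => p (x 0).unpair.1 (Function.update x 0 (x 0).unpair.2) := by
  -- The first move ranges over a discrete space, so continuity may be checked with it fixed.
  have h : Continuous fun q : ℕ × (ℕ → ℕ) =>
      p q.1.unpair.1 (Function.update q.2 0 q.1.unpair.2) :=
    continuous_prod_of_discrete_left.2 fun n => by
      have hu : Continuous fun x : ℕ → ℕ => Function.update x 0 n.unpair.2 :=
        continuous_id.update 0 continuous_const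
      exact (hp n.unpair.1).comp hu
  have h0 : Continuous fun x : ℕ → ℕ => (x 0, x) := (continuous_apply 0).prodMk continuous_id
  exact h.comp h0

theorem surjective_of_first_move {X : Type*} {p : ℕ → (ℕ → ℕ) → X}
    (hp : ∀ x, ∃ a y, p a y = x) :
    Function.Surjective fun x : ℕ → ℕ =>
      p (x 0).unpair.1 (Function.update x 0 (x 0).unpair.2) := by
  intro z
  obtain ⟨a, y, rfl⟩ := hp z
  exact ⟨Function.update y 0 (Nat.pair a (y 0)), by simp⟩

/-! ### Cantor sets of pairwise inequivalent points -/

/-- Fixing the coordinates up to some `n` and leaving the others free embeds the whole space in `U`;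
the diagonal argument then applies. -/
theorem IsOpen.not_countable_cantor {U : Set (ℕ → Bool)} (hU : IsOpen U) (hne : U.Nonempty) :
    ¬ U.Countable := by
  obtain ⟨x, hx⟩ := hne
  obtain ⟨I, u, hu, hIU⟩ := isOpen_pi_iff.1 hU x hx
  obtain ⟨n, hn⟩ := I.bddAbove
  let g : (ℕ → Bool) → (ℕ → Bool) := fun y k => if k ≤ n then x k else y (k - (n + 1))
  have hg : Function.Injective g := by
    intro y z h
    funext k
    have := congrFun h (k + (n + 1))
    simpa [g, show ¬ (k + (n + 1) ≤ n) by omega] using this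
  have hgU : ∀ y, g y ∈ U := fun y => hIU fun i hi => by
    simpa [g, hn hi] using (hu i hi).2
  intro hc
  have h1 : (g ⁻¹' U).Countable := hc.preimage_of_injOn hg.injOn
  rw [show g ⁻¹' U = Set.univ from Set.eq_univ_of_forall hgU, Set.countable_univ_iff] at h1
  obtain ⟨f, hf⟩ := exists_surjective_nat (ℕ → Bool)
  obtain ⟨m, hm⟩ := hf fun k => !(f k k)
  exact (Bool.eq_not_self _).1 (congrFun hm m)

/-- Members of finitely many sets which are pairwise inequivalent, for an equivalence relation
with countable classes. -/
theorem Setoid.exists_pairwise_not_rel {M : Type*} (E : Setoid M)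
    (hE : ∀ x, {y | E x y}.Countable) {S : Type*} (U : S → Set M)
    (hU : ∀ s, ¬ (U s).Countable) (t : Finset S) :
    ∃ p : S → M, (∀ s, p s ∈ U s) ∧ ∀ s ∈ t, ∀ s' ∈ t, s ≠ s' → ¬ E (p s) (p s') := by
  classical
  induction t using Finset.induction_on with
  | empty =>
    have hne : ∀ s, (U s).Nonempty := fun s =>
      Set.nonempty_iff_ne_empty.2 fun h => hU s (h ▸ Set.countable_empty)
    choose p hp using hne
    exact ⟨p, hp, by simp⟩
  | insert a t ha ih =>
    obtain ⟨p, hp, hpE⟩ := ih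
    have hc : (⋃ s ∈ t, {y | E (p s) y}).Countable :=
      t.countable_toSet.biUnion fun s _ => hE (p s)
    obtain ⟨q, hqU, hq⟩ : ∃ q ∈ U a, q ∉ ⋃ s ∈ t, {y | E (p s) y} := by
      by_contra! h
      exact hU a (hc.mono h)
    have hq' : ∀ s ∈ t, ¬ E (p s) q := by simpa using hq
    have hne : ∀ s ∈ t, s ≠ a := fun s hs h => ha (h ▸ hs)
    refine ⟨Function.update p a q, fun s => ?_, fun s hs s' hs' hss => ?_⟩
    · by_cases h : s = a
      · subst h; simpa using hqU
      · simpa [h] using hp s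
    · rcases Finset.mem_insert.1 hs with rfl | hst
      · have hs' := (Finset.mem_insert.1 hs').resolve_left hss.symm
        rw [Function.update_self, Function.update_of_ne (hne _ hs')]
        exact fun h => hq' _ hs' (E.symm h)
      · rcases Finset.mem_insert.1 hs' with rfl | hst'
        · rw [Function.update_self, Function.update_of_ne (hne _ hst)]
          exact hq' _ hst
        · rw [Function.update_of_ne (hne _ hst), Function.update_of_ne (hne _ hst')]
          exact hpE _ hst _ hst' hss

/-- A continuous function on a power of the Cantor space is nearly constant on the classes of
agreement on some finite set of coordinates. -/
theorem exists_finset_dist_lt {ι M : Type*} [PseudoMetricSpace M] (f : C(ι → Bool, M)) {ε : ℝ}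
    (hε : 0 < ε) : ∃ F : Finset ι, ∀ a b : ι → Bool, (∀ i ∈ F, a i = b i) → dist (f a) (f b) < ε := by
  have huc := CompactSpace.uniformContinuous_of_continuous f.continuous
  have h1 : {q : (ι → Bool) × (ι → Bool) | dist (f q.1) (f q.2) < ε} ∈ uniformity (ι → Bool) :=
    huc (Metric.dist_mem_uniformity hε)
  have h2 : uniformity (ι → Bool) =
      ⨅ i, Filter.principal {q : (ι → Bool) × (ι → Bool) | q.1 i = q.2 i} := by
    rw [Pi.uniformity]
    refine iInf_congr fun i => ?_
    rw [DiscreteUniformity.eq_principal_setRelId, Filter.comap_principal]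
    rfl
  rw [h2, (Filter.hasBasis_iInf_principal_finite _).mem_iff] at h1
  obtain ⟨t, ht, hsub⟩ := h1
  refine ⟨ht.toFinset, fun a b hab => ?_⟩
  have h3 : (a, b) ∈ {q : (ι → Bool) × (ι → Bool) | dist (f q.1) (f q.2) < ε} :=
    hsub (by simpa using hab)
  exact h3

/-- Baire category in the complete space `C(ι → Bool, M)`: for each coordinate `i` and each `n`, the
functions `f` that send no two points differing at `i` to a pair in `R n` form a dense open set. -/
theorem exists_continuous_pairwise_not_rel {ι M : Type*} [Countable ι] [MetricSpace M]
    [CompleteSpace M] [Nonempty M] (hM : ∀ U : Set M, IsOpen U → U.Nonempty → ¬ U.Countable)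
    (E : Setoid M) (hE : ∀ x, {y | E x y}.Countable) (R : ℕ → Set (M × M))
    (hR : ∀ n, IsClosed (R n)) (hER : ∀ x y, E x y ↔ ∃ n, (x, y) ∈ R n) :
    ∃ f : C(ι → Bool, M), ∀ a b, E (f a) (f b) → a = b := by
  classical
  let D : ι × ℕ → Set C(ι → Bool, M) := fun k =>
    {f | ∀ a b : ι → Bool, a k.1 ≠ b k.1 → (f a, f b) ∉ R k.2}
  have hDo : ∀ k, IsOpen (D k) := by
    intro k
    -- Membership in `D k` says that `f × f` maps this compact set into the open complement of `R
    -- k.2`, an open condition in the compact-open topology.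
    have hK : IsCompact {q : (ι → Bool) × (ι → Bool) | q.1 k.1 ≠ q.2 k.1} := by
      refine IsClosed.isCompact ?_
      have : IsClopen ((fun q : (ι → Bool) × (ι → Bool) => (q.1 k.1, q.2 k.1)) ⁻¹'
          {q | q.1 ≠ q.2}) :=
        (isClopen_discrete _).preimage (by fun_prop)
      exact this.1
    have hop := ContinuousMap.isOpen_setOfPred_mapsTo hK (hR k.2).isOpen_compl
    have hc : Continuous fun f : C(ι → Bool, M) => f.prodMap f :=
      ContinuousMap.continuous_of_continuous_uncurry _ (by
        change Continuous fun q : C(ι → Bool, M) × ((ι → Bool) × (ι → Bool)) =>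
          (q.1 q.2.1, q.1 q.2.2)
        fun_prop)
    convert hop.preimage hc using 1
    ext f
    simp only [D, Set.mem_ofPred_eq, Set.mem_preimage, Set.MapsTo, Prod.forall]
    rfl
  have hDd : ∀ k, Dense (D k) := by
    intro k
    rw [Metric.dense_iff]
    intro f ε hε
    obtain ⟨F₀, hF₀⟩ := exists_finset_dist_lt f (half_pos hε)
    -- Up to `ε / 2`, `f` depends only on finitely many coordinates; its finitely many approximate
    -- values are moved to inequivalent points. Including `k.1` makes points that differ there
    -- receive different values of `p`.
    let F := insert k.1 F₀
    let ext : (F → Bool) → (ι → Bool) := fun s i => if h : i ∈ F then s ⟨i, h⟩ else false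
    let res : (ι → Bool) → (F → Bool) := fun a i => a i
    obtain ⟨p, hp, hpE⟩ := E.exists_pairwise_not_rel hE
      (fun s : F → Bool => Metric.ball (f (ext s)) (ε / 2))
      (fun s => hM _ Metric.isOpen_ball ⟨_, Metric.mem_ball_self (half_pos hε)⟩) Finset.univ
    have hres : Continuous res := by fun_prop
    let g : C(ι → Bool, M) := ⟨fun a => p (res a), continuous_of_discreteTopology.comp hres⟩
    refine ⟨g, ?_, fun a b hab h => ?_⟩
    · rw [Metric.mem_ball, ContinuousMap.dist_lt_iff hε]
      intro a
      have h1 : dist (p (res a)) (f (ext (res a))) < ε / 2 := hp (res a)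
      have h2 : dist (f (ext (res a))) (f a) < ε / 2 :=
        hF₀ _ _ fun i hi => by simp [ext, res, F, hi]
      calc dist (g a) (f a) ≤ _ := dist_triangle _ (f (ext (res a))) _
        _ < ε := by change dist (p (res a)) _ + _ < ε; linarith
    · refine hpE (res a) (Finset.mem_univ _) (res b) (Finset.mem_univ _) (fun h => hab ?_)
        ((hER _ _).2 ⟨k.2, h⟩)
      exact congrFun h ⟨k.1, Finset.mem_insert_self _ _⟩
  have : Nonempty C(ι → Bool, M) := ⟨ContinuousMap.const _ (Classical.arbitrary M)⟩
  obtain ⟨f, hf⟩ := (dense_iInter_of_isOpen hDo hDd).nonempty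
  refine ⟨f, fun a b hab => ?_⟩
  by_contra hne
  obtain ⟨i, hi⟩ := Function.ne_iff.1 hne
  obtain ⟨n, hn⟩ := (hER _ _).1 hab
  exact Set.mem_iInter.1 hf (i, n) a b hi hn

/-- An equivalence relation on an uncountable Polish space whose classes are the sets
`{T n x | n ∈ ℕ}`, for continuous functions `T n`, has a Cantor set of inequivalent points. -/
theorem exists_continuous_pairwise_not_rel_of_orbit {ι X : Type*} [Countable ι]
    [TopologicalSpace X] [PolishSpace X] [Uncountable X] (E : Setoid X) (T : ℕ → X → X)
    (hT : ∀ n, Continuous (T n)) (hET : ∀ x y, E x y ↔ ∃ n, T n x = y) :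
    ∃ f : (ι → Bool) → X, Continuous f ∧ ∀ a b, E (f a) (f b) → a = b := by
  -- `X` may have isolated points, so the category argument is run on a Cantor set inside it.
  obtain ⟨c, -, hc, hci⟩ := isClosed_univ.exists_nat_bool_injection_of_not_countable (α := X)
    (by rw [Set.countable_univ_iff]; exact not_countable)
  let := TopologicalSpace.upgradeIsCompletelyMetrizable (ℕ → Bool)
  obtain ⟨f, hf⟩ := exists_continuous_pairwise_not_rel (ι := ι) (M := ℕ → Bool)
    (fun U hU hne => hU.not_countable_cantor hne) (E.comap c)
    (fun x => by
      have h : {y | E.comap c x y} ⊆ c ⁻¹' Set.range fun n => T n (c x) := fun y hy =>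
        (hET _ _).1 hy
      exact ((Set.countable_range _).preimage_of_injOn hci.injOn).mono h)
    (fun n => {q | T n (c q.1) = c q.2})
    (fun n => isClosed_eq ((hT n).comp (hc.comp continuous_fst)) (hc.comp continuous_snd))
    (fun x y => hET _ _)
  exact ⟨c ∘ f, hc.comp f.continuous, hf⟩

/-! ### The Baire space inside the Cantor space -/

/-- The graph of `x : ℕ → ℕ`, as a point of the Cantor space. -/
def graphCode (x : ℕ → ℕ) : ℕ × ℕ → Bool :=
  fun q => decide (x q.1 = q.2)

theorem graphCode_isInducing : Topology.IsInducing graphCode := by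
  have hcont : Continuous graphCode := continuous_pi fun q =>
    (continuous_of_discreteTopology (f := fun n : ℕ => decide (n = q.2))).comp
      (continuous_apply q.1)
  -- Conversely, the subbasic set `x i = j` is cut out by the single bit at `(i, j)`.
  refine ⟨le_antisymm hcont.le_induced (continuous_id_iff_le.1 ?_)⟩
  let _ : TopologicalSpace (ℕ → ℕ) := TopologicalSpace.induced graphCode inferInstance
  refine continuous_pi fun i => continuous_discrete_rng.2 fun j => ?_
  have hc : Continuous fun z : ℕ × ℕ → Bool => z (i, j) := continuous_apply (i, j)
  have ho := (isOpen_discrete {true}).preimage hc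
  convert ho.preimage (continuous_induced_dom (f := graphCode)) using 1
  ext x
  simp [graphCode]

theorem graphCode_injective : Function.Injective graphCode := by
  intro x y h
  funext i
  simpa [graphCode] using congrFun h (i, y i)

/-- The images of open and of closed subsets of the Baire space in the Cantor space. -/
theorem exists_graphCode_image_eq_iInter {U : Set (ℕ → ℕ)} (hU : IsOpen U ∨ IsClosed U) :
    ∃ D : ℕ → Set (ℕ × ℕ → Bool), (∀ i, IsSigma0 2 (D i)) ∧ graphCode '' U = ⋂ i, D i := by
  obtain ⟨V, hV, rfl⟩ : ∃ V, IsSigma0 2 V ∧ graphCode ⁻¹' V = U := by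
    rcases hU with hU | hU
    · obtain ⟨V, hV, h⟩ := graphCode_isInducing.isOpen_iff.1 hU
      exact ⟨V, hV.isSigma0_two, h⟩
    · obtain ⟨V, hV, h⟩ := graphCode_isInducing.isClosed_iff.1 hU
      exact ⟨V, hV.isSigma0_two, h⟩
  -- In `C i`, row `i` has exactly one `true`; the intersection of all `C i` is the range of
  -- `graphCode`.
  let C : ℕ → Set (ℕ × ℕ → Bool) := fun i => ⋃ j : ℕ, {z | ∀ k, z (i, k) = decide (j = k)}
  refine ⟨fun n => n.casesOn V C, ?_, ?_⟩
  · rintro (_ | i)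
    · exact hV
    · refine IsSigma0.iUnion fun j => IsClosed.isSigma0_two ?_
      rw [Set.ofPred_forall]
      exact isClosed_iInter fun k => isClosed_eq (continuous_apply _) continuous_const
  · ext z
    rw [Set.mem_iInter]
    constructor
    · rintro ⟨x, hx, rfl⟩ (_ | i)
      · exact hx
      · exact Set.mem_iUnion.2 ⟨x i, fun k => rfl⟩
    · intro h
      have hC : ∀ i, ∃ j : ℕ, ∀ k, z (i, k) = decide (j = k) := fun i =>
        Set.mem_iUnion.1 (h (i + 1))
      choose x hx using hC
      have hxz : graphCode x = z := funext fun q => (hx q.1 q.2).symm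
      exact ⟨x, by rw [Set.mem_preimage, hxz]; exact h 0, hxz⟩

/-- Images under the injective `f` commute with intersections, and compactness keeps images of `Σ⁰₂`
sets `Σ⁰₂`. -/
theorem isPi0_image_comp_graphCode {X : Type*} [TopologicalSpace X] [T2Space X]
    {f : (ℕ × ℕ → Bool) → X} (hf : Continuous f) (hfi : Function.Injective f)
    {U : Set (ℕ → ℕ)} (hU : IsOpen U ∨ IsClosed U) :
    IsPi0 3 ((f ∘ graphCode) '' U) := by
  obtain ⟨D, hD, h⟩ := exists_graphCode_image_eq_iInter hU
  rw [Set.image_comp, h, hfi.injOn.image_iInter_eq]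
  exact isPi0_iInter fun i => (hD i).image_of_compactSpace hf

/-! ### Determinacy -/

/-- Let the classes of `E` be the sets `{T n x | n ∈ ℕ}`, for continuous functions `T n`. If there
are uncountably many points, then `(Γ, E)`-determinacy implies `Γ`-determinacy. -/
theorem Pointclass.RelDeterminacy.determinacy_of_orbit {X : Type} [TopologicalSpace X]
    [PolishSpace X] [Uncountable X] {E : Setoid X} {T : ℕ → X → X}
    (hT : ∀ n, Continuous (T n)) (hET : ∀ x y, E x y ↔ ∃ n, T n x = y)
    {Γ : Pointclass} (hΓ : Γ.IsReasonable) (hdet : Γ.RelDeterminacy E) : Γ.Determinacy := by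
  classical
  intro A hA
  obtain ⟨f, hf, hfE⟩ := exists_continuous_pairwise_not_rel_of_orbit (ι := ℕ × ℕ) E T hT hET
  have hfi : Function.Injective f := fun a b h => hfE a b (h ▸ E.refl _)
  let φ : (ℕ → ℕ) → X := f ∘ graphCode
  have hφ : Continuous φ := hf.comp graphCode_isInducing.continuous
  have hφE : ∀ y z, E (φ y) (φ z) → y = z := fun y z h => graphCode_injective (hfE _ _ h)
  let sat : Set (ℕ → ℕ) → Set X := fun U => ⋃ n, T n ⁻¹' (φ '' U)
  have mem_sat : ∀ U x, x ∈ sat U ↔ ∃ y ∈ U, E x (φ y) := by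
    intro U x
    simp only [sat, Set.mem_iUnion, Set.mem_preimage, Set.mem_image, hET]
    constructor
    · rintro ⟨n, y, hy, h⟩
      exact ⟨y, hy, n, h.symm⟩
    · rintro ⟨y, hy, n, h⟩
      exact ⟨n, y, hy, h.symm⟩
  -- The image `φ '' U` is `Π⁰₃`, and the saturation is a countable union of its continuous
  -- preimages.
  have hsat : ∀ U, IsOpen U ∨ IsClosed U → IsSigma0 4 (sat U) := fun U hU =>
    IsSigma0.iUnion fun n => ((isPi0_image_comp_graphCode hf hfi hU).isSigma0_succ).preimage (hT n)
  have hS : IsSigma0 4 (sat Set.univ) := hsat _ (Or.inl isOpen_univ)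
  have hSc : IsSigma0 5 (sat Set.univ)ᶜ := hS.isDelta0_succ.2
  -- The inverse of `φ` modulo `E`.
  have hr : ∀ x, ∃ y, x ∈ sat Set.univ → E x (φ y) := by
    intro x
    by_cases hx : x ∈ sat Set.univ
    · obtain ⟨y, -, hy⟩ := (mem_sat _ _).1 hx
      exact ⟨y, fun _ => hy⟩
    · exact ⟨0, fun h => (hx h).elim⟩
  -- The default `0` off the saturation is why `r ⁻¹' U` gains the whole complement exactly when `0
  -- ∈ U`.
  let r : X → (ℕ → ℕ) := fun x => if x ∈ sat Set.univ then (hr x).choose else 0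
  have r_spec : ∀ x ∈ sat Set.univ, E x (φ (r x)) := fun x hx => by
    simp only [r, if_pos hx]
    exact (hr x).choose_spec hx
  have r_eq : ∀ x y, E x (φ y) → r x = y := fun x y h =>
    hφE _ _ (E.trans (E.symm (r_spec x ((mem_sat _ _).2 ⟨y, trivial, h⟩))) h)
  have r_preimage : ∀ U, r ⁻¹' U = sat U ∪ if 0 ∈ U then (sat Set.univ)ᶜ else ∅ := by
    intro U
    ext x
    by_cases hx : x ∈ sat Set.univ
    · have h1 : x ∈ sat U ↔ r x ∈ U := by
        rw [mem_sat]
        exact ⟨fun ⟨y, hy, h⟩ => (r_eq x y h).symm ▸ hy, fun h => ⟨_, h, r_spec x hx⟩⟩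
      split_ifs <;> simp [h1, hx]
    · have h1 : x ∉ sat U := fun h => by
        obtain ⟨y, -, h⟩ := (mem_sat _ _).1 h
        exact hx ((mem_sat _ _).2 ⟨y, trivial, h⟩)
      have h2 : r x = 0 := if_neg hx
      split_ifs with h0 <;> simp [h1, h2, hx, h0]
  have hrU : ∀ U, IsOpen U ∨ IsClosed U → IsSigma0 6 (r ⁻¹' U) := by
    intro U hU
    rw [r_preimage]
    split_ifs
    · exact (hsat U hU).succ.succ.union hSc.succ
    · simpa using (hsat U hU).succ.succ
  have hrΔ : Delta0Measurable 6 r := fun U hU =>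
    ⟨hrU U (Or.inl hU), hrU Uᶜ (Or.inr hU.isClosed_compl)⟩
  have hSΔ : IsDelta0 6 (sat Set.univ) := hS.succ.isDelta0_succ
  let B : Set X := r ⁻¹' A ∩ sat Set.univ
  have hB : Γ.Mem B := hΓ.inter_mem _ _ (hΓ.subst_mem r A hrΔ hA) hSΔ
  have mem_B : ∀ x y, E x (φ y) → (x ∈ B ↔ y ∈ A) := by
    intro x y h
    have hx : x ∈ sat Set.univ := (mem_sat _ _).2 ⟨y, trivial, h⟩
    simp only [B, Set.mem_inter_iff, Set.mem_preimage, r_eq x y h, hx, and_true]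
  have hBE : ∀ x y, E x y → x ∈ B → y ∈ B := by
    intro x y h hx
    have h1 := r_spec x hx.2
    exact (mem_B y _ (E.trans (E.symm h) h1)).2 ((mem_B x _ h1).1 hx)
  -- A continuous function onto the points that are equivalent to no `φ y`, if there are any.
  obtain ⟨g, hg, hgS, hgA⟩ : ∃ g : (ℕ → ℕ) → X, Continuous g ∧
      (∀ x ∉ sat Set.univ, ∃ y, g y = x) ∧ ∀ y, g y ∈ B → y ∈ A := by
    let _ : MeasurableSpace X := borel X
    have : BorelSpace X := ⟨rfl⟩
    -- The complement is Borel, hence analytic: empty, where `φ` serves as `g`, or a continuous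
    -- image of `ω^ω`, where `g` never enters `B`.
    have han := hSc.measurableSet.analyticSet
    rw [MeasureTheory.AnalyticSet] at han
    rcases han with h | ⟨g, hg, hgr⟩
    · refine ⟨φ, hφ, fun x hx => ?_, fun y => (mem_B _ y (E.refl _)).1⟩
      exact absurd (h ▸ (hx : x ∈ (sat Set.univ)ᶜ)) (Set.notMem_empty x)
    · refine ⟨g, hg, fun x hx => ?_, fun y hy => ?_⟩
      · have hx' : x ∈ (sat Set.univ)ᶜ := hx
        rwa [← hgr] at hx'
      · have : g y ∈ (sat Set.univ)ᶜ := hgr ▸ Set.mem_range_self y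
        exact absurd hy.2 this
  let p : ℕ → (ℕ → ℕ) → X := fun a => a.casesOn g fun n => T n ∘ φ
  have hpT : ∀ n y, T n (φ y) ∈ B ↔ y ∈ A := fun n y =>
    mem_B _ _ (E.symm ((hET _ _).2 ⟨n, rfl⟩))
  -- The harmless index `1` selects `T 0 ∘ φ`; index `0` is reserved for `g`.
  refine Determined.of_preimage (B := B) p ?_ 1 (fun y hy => (hpT 0 y).2 hy)
    (hdet _ (continuous_of_first_move ?_) (surjective_of_first_move ?_) B hB
      fun x y h => ⟨hBE x y h, hBE y x (E.symm h)⟩)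
  · rintro (_ | n) y hy
    · exact hgA y hy
    · exact (hpT n y).1 hy
  · rintro (_ | n)
    · exact hg
    · exact (hT n).comp hφ
  · intro x
    by_cases hx : x ∈ sat Set.univ
    · obtain ⟨n, hn⟩ := (hET _ _).1 (E.symm (r_spec x hx))
      exact ⟨n + 1, r x, hn⟩
    · obtain ⟨y, hy⟩ := hgS x hx
      exact ⟨0, y, hy⟩

/-! ### The shift -/

/-- The action of `m : ℤ` on a subshift. -/
def subshiftMap (W : Finset (List Bool)) (m : ℤ) (x : subshift W) : subshift W :=
  ⟨fun k => x.1 (k - m), fun k w hw h => x.2 (k - m) w hw fun i => by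
    rw [← h i, show k - m + (i : ℤ) = k + i - m by ring]⟩

theorem continuous_subshiftMap (W : Finset (List Bool)) (m : ℤ) :
    Continuous (subshiftMap W m) :=
  Continuous.subtype_mk
    (continuous_pi fun k => by
      have h : Continuous fun x : ℤ → Bool => x (k - m) := continuous_apply (k - m)
      exact h.comp continuous_subtype_val) _

theorem mainTheorem2 (W : Finset (List Bool))
    (hE : Uncountable (Quotient (shiftRel W)))
    (Γ : Pointclass) (hΓ : Γ.IsReasonable)
    (hdet : Γ.RelDeterminacy (shiftRel W)) :
    Γ.Determinacy := by
  have : Uncountable (subshift W) :=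
    (Quotient.mk_surjective (s := shiftRel W)).uncountable
  obtain ⟨e, he⟩ := exists_surjective_nat ℤ
  refine Pointclass.RelDeterminacy.determinacy_of_orbit
    (T := fun n => subshiftMap W (e n)) (fun n => continuous_subshiftMap W _) (fun x y => ?_)
    hΓ hdet
  constructor
  · rintro ⟨m, h⟩
    obtain ⟨n, rfl⟩ := he m
    exact ⟨n, Subtype.ext (funext fun k => (h k).symm)⟩
  · rintro ⟨n, rfl⟩
    exact ⟨e n, fun k => rfl⟩
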